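/- For every real $p\ge 1$ there are constants $\varepsilon_0,C,c>0$ depending only on $p$ such that the following holds for all $0<\varepsilon\le\varepsilon_0$ and all integers $d\ge 1$ and $n\ge C\,d\max\{1,\log d\}/\varepsilon^2$. Let $\mathsf{Lip}_1$ be the set of functions $f:\mathbb{R}\to\mathbb{R}$ with $f(0)=0$ and $|f(x)-f(y)|\le|x-y|$ for all $x,y$, and apply $f$ to vectors entrywise. For $A\in\mathbb{R}^{n\times d}$, $f\in\mathsf{Lip}_1$ and $b\in\mathbb{R}^n$ put $\mathsf{OPT}=\min_{x\in\mathbb{R}^d}\|f(Ax)-b\|_p^p$, and let $x^*$ be a minimizer with the smallest $\|Ax^*\|_p$ among all minimizers. Consider any randomized (adaptive) algorithm that is given $A$ and $f$ and can query the entries of the unknown vector $b$, and that, for all $A\in\mathbb{R}^{n\times d}$, $f\in\mathsf{Lip}_1$ and $b\in\mathbb{R}^n$ for which the minimum is attained, outputs with probability at least $4/5$ a vector $\hat x\in\mathbb{R}^d$ such that $$\|f(A\hat x)-b\|_p^p\le \mathsf{OPT}+\varepsilon\big(\mathsf{OPT}+\|Ax^*\|_p^p\big).$$ If, for all such $A$,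 all $f\in\mathsf{Lip}_1$ and all $b$, the algorithm almost surely makes at most $q$ queries to the entries of $b$, then $q\ge c\,d/\varepsilon^2$. That is, any such algorithm must make $\Omega(d/\varepsilon^2)$ queries. -/

import Mathlib

open MeasureTheory

universe u

/-- `Lip L`: the `L`-Lipschitz functions `f : ℝ → ℝ` with `f 0 = 0`. -/
def Lip (L : ℝ) : Set (ℝ → ℝ) :=
  {f | f 0 = 0 ∧ ∀ x y : ℝ, |f x - f y| ≤ L * |x - y|}

/-- `‖v‖_p ^ p = ∑ i, |v i| ^ p`, the `p`-th power of the `ℓ_p` norm on `ℝ ^ n`. -/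
noncomputable def lpPow {n : ℕ} (p : ℝ) (v : Fin n → ℝ) : ℝ :=
  ∑ i, |v i| ^ p

/-- The regression objective `‖f(Ax) - b‖_p ^ p`, with `f` applied entrywise. -/
noncomputable def loss {n d : ℕ} (p : ℝ) (A : Matrix (Fin n) (Fin d) ℝ) (f : ℝ → ℝ)
    (b : Fin n → ℝ) (x : Fin d → ℝ) : ℝ :=
  lpPow p (fun i => f (A.mulVec x i) - b i)

/-- `x` attains `OPT = min_y ‖f(Ay) - b‖_p ^ p`. -/
def IsMinimizer {n d : ℕ} (p : ℝ) (A : Matrix (Fin n) (Fin d) ℝ) (f : ℝ → ℝ)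
    (b : Fin n → ℝ) (x : Fin d → ℝ) : Prop :=
  ∀ y : Fin d → ℝ, loss p A f b x ≤ loss p A f b y

/-- `x` is an admissible choice of `x*`: a minimizer of the objective which, among all
minimizers, has the smallest `‖Ax‖_p ^ p`. -/
def IsMinNormMinimizer {n d : ℕ} (p : ℝ) (A : Matrix (Fin n) (Fin d) ℝ) (f : ℝ → ℝ)
    (b : Fin n → ℝ) (x : Fin d → ℝ) : Prop :=
  IsMinimizer p A f b x ∧
    ∀ y : Fin d → ℝ, IsMinimizer p A f b y → lpPow p (A.mulVec x) ≤ lpPow p (A.mulVec y)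

/-- The error guarantee `‖f(A x̂) - b‖_p ^ p ≤ OPT + ε (OPT + L ^ p ‖A x*‖_p ^ p)`.
Here `OPT` is the objective at `x*`; the right-hand side is the same for all choices of `x*`.
If the objective has no minimizer, `OPT` and `x*` do not exist and nothing is required. -/
def ErrorGuarantee {n d : ℕ} (p L ε : ℝ) (A : Matrix (Fin n) (Fin d) ℝ) (f : ℝ → ℝ)
    (b : Fin n → ℝ) (xhat : Fin d → ℝ) : Prop :=
  ∀ xstar : Fin d → ℝ, IsMinNormMinimizer p A f b xstar →
    loss p A f b xhat ≤
      loss p A f b xstar + ε * (loss p A f b xstar + L ^ p * lpPow p (A.mulVec xstar))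

/-- A deterministic adaptive algorithm with query access to the entries of a vector in `ℝ ^ n`
and with output in `ℝ ^ d`: it either stops with an output, or queries an entry and
continues in a way that depends on the value it has read. -/
inductive QueryTree (n d : ℕ) : Type
  | output (x : Fin d → ℝ) : QueryTree n d
  | query (i : Fin n) (next : ℝ → QueryTree n d) : QueryTree n d

/-- The output of the algorithm when the queries are answered by `b`. -/
def QueryTree.eval {n d : ℕ} (b : Fin n → ℝ) : QueryTree n d → (Fin d → ℝ)
  | .output x => x
  | .query i next => (next (b i)).eval b

/-- The number of queries the algorithm makes when they are answered by `b`. -/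
def QueryTree.numQueries {n d : ℕ} (b : Fin n → ℝ) : QueryTree n d → ℕ
  | .output _ => 0
  | .query i next => (next (b i)).numQueries b + 1

/-- A randomized algorithm which is given `A` and `f` and has query access to `b`: a random
seed `ω`, together with `A` and `f`, determines an adaptive query algorithm. For every input,
the output is a random vector. The seed space is an arbitrary probability space. -/
structure RandomizedAlgorithm (n d : ℕ) where
  Ω : Type u
  [measurableSpace : MeasurableSpace Ω]
  P : Measure Ω
  [isProbabilityMeasure : IsProbabilityMeasure P]
  tree : Matrix (Fin n) (Fin d) ℝ → (ℝ → ℝ) → Ω → QueryTree n d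
  measurable_eval : ∀ (A : Matrix (Fin n) (Fin d) ℝ) (f : ℝ → ℝ) (b : Fin n → ℝ),
    Measurable fun ω => (tree A f ω).eval b

attribute [instance] RandomizedAlgorithm.measurableSpace
  RandomizedAlgorithm.isProbabilityMeasure

/-- On every input `A`, `f ∈ Lip 1`, `b`, the output satisfies the error guarantee (with `L = 1`)
with probability at least `4/5`. -/
def RandomizedAlgorithm.Succeeds {n d : ℕ} (𝒜 : RandomizedAlgorithm n d) (p ε : ℝ) : Prop :=
  ∀ (A : Matrix (Fin n) (Fin d) ℝ), ∀ f ∈ Lip 1, ∀ b : Fin n → ℝ,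
    4 / 5 ≤ 𝒜.P {ω | ErrorGuarantee p 1 ε A f b ((𝒜.tree A f ω).eval b)}

/-- On every input `A`, `f ∈ Lip 1`, `b`, the algorithm almost surely makes at most `q`
queries to the entries of `b`. -/
def RandomizedAlgorithm.MakesAtMost {n d : ℕ} (𝒜 : RandomizedAlgorithm n d) (q : ℕ) : Prop :=
  ∀ (A : Matrix (Fin n) (Fin d) ℝ), ∀ f ∈ Lip 1, ∀ b : Fin n → ℝ,
    ∀ᵐ ω ∂𝒜.P, (𝒜.tree A f ω).numQueries b ≤ q

/-!
Put `r ≈ 1 / ε`, and give each of the `d` coordinates about `r ^ 2` pairs of rows `±1` whose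
responses encode hidden uniform bits; let `D j` be the sum of the corresponding signs, which is
typically of size at least `r`. Replacing `x j` by its mirror image, of the opposite sign, changes
the loss of every pair in the coordinate `j` by exactly `±1`, hence the total loss by
`± D j`. So an approximate minimizer has the same sign as `D j`, up to a small total weight.

An algorithm that finds these signs has to read many bits. Let `φ` be an odd Lipschitz truncation
of `D j` at scale `r`, and let `S j` be the part of `D j` that has been read. Flipping all unread
bits of a coordinate does not change the output, so the output sign correlates with `φ (D j)` by
no more than `|S j| / r` on average. As every query increases the mean of `∑ j, S j ^ 2` by at most
`1`, a constant correlation in all `d` coordinates requires about `d * r ^ 2` queries.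
-/

open Finset
open scoped BigOperators

/-- The sign `±1` encoded by a bit. -/
def boolSign (a : Bool) : ℝ := bif a then 1 else -1

theorem boolSign_not (a : Bool) : boolSign (!a) = -boolSign a := by
  cases a <;> simp [boolSign]

theorem boolSign_sq (a : Bool) : boolSign a ^ 2 = 1 := by
  cases a <;> simp [boolSign]

theorem abs_boolSign (a : Bool) : |boolSign a| = 1 := by
  cases a <;> simp [boolSign]

theorem abs_boolSign_mul (a : Bool) (x : ℝ) : |boolSign a * x| = |x| := by
  rw [abs_mul, abs_boolSign, one_mul]

section Flip

variable {ι : Type*} [DecidableEq ι] {U V : Finset ι} {Q : Finset (ι → Bool)}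

/-- The bits `t`, negated at the positions in `V`. -/
def flipOn (V : Finset ι) (t : ι → Bool) : ι → Bool := V.piecewise (fun i => !t i) t

theorem flipOn_of_mem {i : ι} (hi : i ∈ V) (t : ι → Bool) : flipOn V t i = !t i :=
  piecewise_eq_of_mem _ _ _ hi

theorem flipOn_of_notMem {i : ι} (hi : i ∉ V) (t : ι → Bool) : flipOn V t i = t i :=
  piecewise_eq_of_notMem _ _ _ hi

theorem flipOn_flipOn (V : Finset ι) (t : ι → Bool) : flipOn V (flipOn V t) = t := by
  funext i
  by_cases hi : i ∈ V <;> simp [flipOn, hi]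

theorem flipOn_mem (hQ : DependsOn (· ∈ Q) (U : Set ι)) (h : Disjoint U V) {t : ι → Bool}
    (ht : t ∈ Q) : flipOn V t ∈ Q :=
  (hQ fun _ hi => flipOn_of_notMem (disjoint_left.1 h hi) t).mpr ht

theorem sum_flipOn {M : Type*} [AddCommMonoid M] (hQ : DependsOn (· ∈ Q) (U : Set ι))
    (h : Disjoint U V) (g : (ι → Bool) → M) : ∑ t ∈ Q, g (flipOn V t) = ∑ t ∈ Q, g t :=
  sum_nbij' (flipOn V) (flipOn V) (fun _ => flipOn_mem hQ h) (fun _ => flipOn_mem hQ h)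
    (fun t _ => flipOn_flipOn V t) (fun t _ => flipOn_flipOn V t) fun _ _ => rfl

end Flip

section BlockSum

variable {ι J : Type*} [DecidableEq J] (blk : ι → J)

/-- The sum of the signs of the bits `t i` with `i ∈ U` in the block `blk i = j`. In the lower
bound, `U` is the set of bits that an algorithm has read. -/
def blockSum (U : Finset ι) (t : ι → Bool) (j : J) : ℝ :=
  ∑ i ∈ U with blk i = j, boolSign (t i)

variable {U V : Finset ι} {Q : Finset (ι → Bool)}

theorem blockSum_add_blockSum_compl [Fintype ι] [DecidableEq ι] (U : Finset ι) (t : ι → Bool)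
    (j : J) : blockSum blk U t j + blockSum blk Uᶜ t j = blockSum blk univ t j := by
  simp only [blockSum, sum_filter, sum_add_sum_compl]

theorem blockSum_flipOn_of_disjoint [DecidableEq ι] (h : Disjoint U V) (t : ι → Bool) (j : J) :
    blockSum blk U (flipOn V t) j = blockSum blk U t j :=
  sum_congr rfl fun i hi => by
    rw [flipOn_of_notMem (disjoint_left.1 h (mem_filter.1 hi).1)]

theorem blockSum_flipOn_of_subset [DecidableEq ι] (h : U ⊆ V) (t : ι → Bool) (j : J) :
    blockSum blk U (flipOn V t) j = -blockSum blk U t j := by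
  rw [blockSum, blockSum, ← sum_neg_distrib]
  exact sum_congr rfl fun i hi => by rw [flipOn_of_mem (h (mem_filter.1 hi).1), boolSign_not]

theorem blockSum_insert_sq [DecidableEq ι] {k : ι} (hk : k ∉ U) (t : ι → Bool) (j : J) :
    blockSum blk (insert k U) t j ^ 2 = blockSum blk U t j ^ 2 +
      if blk k = j then 2 * (boolSign (t k) * blockSum blk U t j) + 1 else 0 := by
  rw [blockSum, filter_insert]
  split_ifs
  · rw [sum_insert (by simp [hk]), ← blockSum, add_sq, boolSign_sq]
    ring
  · rw [← blockSum, add_zero]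

theorem sum_boolSign_mul_blockSum_eq_zero (hQ : DependsOn (· ∈ Q) (U : Set ι)) {k : ι}
    (hk : k ∉ U) (j : J) : ∑ t ∈ Q, boolSign (t k) * blockSum blk U t j = 0 := by
  classical
  have hdisj : Disjoint U {k} := disjoint_singleton_right.2 hk
  have hflip := sum_flipOn hQ hdisj fun t => boolSign (t k) * blockSum blk U t j
  simp only [flipOn_of_mem (mem_singleton_self k), boolSign_not,
    blockSum_flipOn_of_disjoint blk hdisj, neg_mul, sum_neg_distrib] at hflip
  linarith

theorem sum_blockSum_insert_sq_le [DecidableEq ι] [Fintype J]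
    (hQ : DependsOn (· ∈ Q) (U : Set ι)) (k : ι) :
    ∑ t ∈ Q, ∑ j, blockSum blk (insert k U) t j ^ 2 ≤
      ∑ t ∈ Q, (∑ j, blockSum blk U t j ^ 2 + 1) := by
  by_cases hk : k ∈ U
  · rw [insert_eq_of_mem hk]
    exact sum_le_sum fun t _ => le_add_of_nonneg_right zero_le_one
  · have hcross : ∑ t ∈ Q, 2 * (boolSign (t k) * blockSum blk U t (blk k)) = 0 := by
      rw [← mul_sum, sum_boolSign_mul_blockSum_eq_zero blk hQ hk, mul_zero]
    simp only [blockSum_insert_sq blk hk, sum_add_distrib, sum_ite_eq, mem_univ, if_true, hcross,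
      zero_add, le_refl]

end BlockSum

section Correlation

variable {φ : ℝ → ℝ} {K : NNReal} {μ : ℝ}

theorem mul_odd_add_mul_odd_sub_le (hodd : φ.Odd) (hφ : LipschitzWith K φ) (hμ : 0 < μ) {s : ℝ}
    (hs : |s| ≤ 1) (x y : ℝ) :
    s * φ (x + y) + s * φ (x - y) ≤ 2 * (K ^ 2 / (4 * μ) + μ * x ^ 2) := by
  have hdiff : |φ (x + y) - φ (y - x)| ≤ K * (2 * |x|) := by
    refine (hφ.dist_le_mul (x + y) (y - x)).trans_eq ?_
    rw [Real.dist_eq, show x + y - (y - x) = 2 * x by ring, abs_mul, abs_two]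
  have amgm : K * |x| ≤ K ^ 2 / (4 * μ) + μ * x ^ 2 := by
    have hsq : K ^ 2 / (4 * μ) + μ * |x| ^ 2 - K * |x| = (K - 2 * μ * |x|) ^ 2 / (4 * μ) := by
      field_simp
      ring
    rw [← sub_nonneg, ← sq_abs x, hsq]
    positivity
  calc s * φ (x + y) + s * φ (x - y) = s * (φ (x + y) - φ (y - x)) := by
        rw [← neg_sub y x, hodd]
        ring
    _ ≤ |s| * |φ (x + y) - φ (y - x)| := by
        rw [← abs_mul]
        exact le_abs_self _
    _ ≤ 1 * (K * (2 * |x|)) := by gcongr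
    _ ≤ 2 * (K ^ 2 / (4 * μ) + μ * x ^ 2) := by linarith

variable {ι J : Type*} [Fintype ι] [DecidableEq J] (blk : ι → J)

-- Flipping the bits outside `U` turns the block sum `S + R` into `S - R`, with `S` the part in `U`.
theorem sum_const_mul_blockSum_le (hodd : φ.Odd) (hφ : LipschitzWith K φ) (hμ : 0 < μ) {s : ℝ}
    (hs : |s| ≤ 1) {U : Finset ι} {Q : Finset (ι → Bool)} (hQ : DependsOn (· ∈ Q) (U : Set ι))
    (j : J) :
    ∑ t ∈ Q, s * φ (blockSum blk univ t j) ≤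
      ∑ t ∈ Q, (K ^ 2 / (4 * μ) + μ * blockSum blk U t j ^ 2) := by
  classical
  have hflip := sum_flipOn hQ disjoint_compl_right fun t => s * φ (blockSum blk univ t j)
  have hpair := sum_le_sum fun t (_ : t ∈ Q) => mul_odd_add_mul_odd_sub_le hodd hφ hμ hs
    (blockSum blk U t j) (blockSum blk Uᶜ t j)
  simp only [← blockSum_add_blockSum_compl blk U, blockSum_flipOn_of_subset blk subset_rfl,
    blockSum_flipOn_of_disjoint blk disjoint_compl_right, ← sub_eq_add_neg] at hflip ⊢
  rw [sum_add_distrib, hflip, ← mul_sum Q _ (2 : ℝ)] at hpair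
  linarith

variable [Fintype J] {n d : ℕ} {b : (ι → Bool) → Fin n → ℝ} {s : (Fin d → ℝ) → J → ℝ}

theorem QueryTree.sum_corr_le_of_dependsOn (hodd : φ.Odd) (hφ : LipschitzWith K φ) (hμ : 0 < μ)
    (hb : ∀ i, ∃ k, ∃ g : Bool → ℝ, ∀ t, b t i = g (t k)) (hs : ∀ x j, |s x j| ≤ 1)
    (T : QueryTree n d) {U : Finset ι} {Q : Finset (ι → Bool)}
    (hQ : DependsOn (· ∈ Q) (U : Set ι)) :
    ∑ t ∈ Q, ∑ j, s (T.eval (b t)) j * φ (blockSum blk univ t j) ≤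
      ∑ t ∈ Q, (Fintype.card J * (K ^ 2 / (4 * μ)) +
        μ * (∑ j, blockSum blk U t j ^ 2 + T.numQueries (b t))) := by
  classical
  induction T generalizing U Q with
  | output x =>
    rw [sum_comm]
    refine (sum_le_sum fun j _ =>
      sum_const_mul_blockSum_le blk hodd hφ hμ (hs x j) hQ j).trans_eq ?_
    rw [sum_comm]
    simp [numQueries, sum_add_distrib, mul_sum]
  | query i next ih =>
    obtain ⟨k, g, hg⟩ := hb i
    have hfiber (c : Bool) :
        ∑ t ∈ Q with t k = c, ∑ j, s ((query i next).eval (b t)) j * φ (blockSum blk univ t j) ≤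
          ∑ t ∈ Q with t k = c, (Fintype.card J * (K ^ 2 / (4 * μ)) +
            μ * (∑ j, blockSum blk (insert k U) t j ^ 2 + (next (b t i)).numQueries (b t))) := by
      have hQc : DependsOn (· ∈ Q.filter (· k = c)) (insert k U : Finset ι) := by
        intro t t' h
        simp only [mem_filter, h k (mem_insert_self k U),
          hQ fun l hl => h l (mem_insert_of_mem hl)]
      have hb' {t} (ht : t ∈ Q.filter (· k = c)) : b t i = g c := by
        rw [hg, (mem_filter.1 ht).2]
      convert ih (g c) hQc using 1 <;> refine sum_congr rfl fun t ht => ?_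
      · rw [eval, hb' ht]
      · rw [hb' ht]
    calc _ = ∑ c, ∑ t ∈ Q with t k = c,
          ∑ j, s ((query i next).eval (b t)) j * φ (blockSum blk univ t j) :=
        (sum_fiberwise Q (· k) _).symm
      _ ≤ _ := sum_le_sum fun c _ => hfiber c
      _ = ∑ t ∈ Q, (Fintype.card J * (K ^ 2 / (4 * μ)) +
            μ * (∑ j, blockSum blk (insert k U) t j ^ 2 + (next (b t i)).numQueries (b t))) :=
        sum_fiberwise Q (· k) _
      _ ≤ _ := by
        have hstep := mul_le_mul_of_nonneg_left (sum_blockSum_insert_sq_le blk hQ k) hμ.le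
        simp only [numQueries, sum_add_distrib, ← mul_sum, Nat.cast_add, Nat.cast_one] at hstep ⊢
        linarith

theorem QueryTree.expect_corr_le [DecidableEq ι] (hodd : φ.Odd) (hφ : LipschitzWith K φ)
    (hμ : 0 < μ) (hb : ∀ i, ∃ k, ∃ g : Bool → ℝ, ∀ t, b t i = g (t k))
    (hs : ∀ x j, |s x j| ≤ 1) (T : QueryTree n d) {q : ℕ} (hq : ∀ t, T.numQueries (b t) ≤ q) :
    𝔼 t, ∑ j, s (T.eval (b t)) j * φ (blockSum blk univ t j) ≤
      Fintype.card J * (K ^ 2 / (4 * μ)) + μ * q := by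
  have hQ : DependsOn (· ∈ (univ : Finset (ι → Bool))) ((∅ : Finset ι) : Set ι) := by
    simp [DependsOn]
  calc _ ≤ 𝔼 t, (Fintype.card J * (K ^ 2 / (4 * μ)) +
        μ * (∑ j, blockSum blk ∅ t j ^ 2 + T.numQueries (b t))) := by
        rw [Fintype.expect_eq_sum_div_card, Fintype.expect_eq_sum_div_card]
        exact div_le_div_of_nonneg_right (T.sum_corr_le_of_dependsOn blk hodd hφ hμ hb hs hQ)
          (Nat.cast_nonneg _)
    _ ≤ _ := expect_le univ_nonempty fun t _ => by
        simp only [blockSum, filter_empty, sum_empty, ne_eq, OfNat.ofNat_ne_zero,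
          not_false_eq_true, zero_pow, sum_const_zero, zero_add]
        gcongr
        exact hq t

end Correlation

section Anticoncentration

theorem two_mul_add_one_mul_centralBinom_sq_le (k : ℕ) :
    (2 * k + 1) * k.centralBinom ^ 2 ≤ 16 ^ k := by
  induction k with
  | zero => simp
  | succ k ih =>
    refine Nat.le_of_mul_le_mul_left ?_ (show 0 < (k + 1) ^ 2 by positivity)
    calc (k + 1) ^ 2 * ((2 * (k + 1) + 1) * (k + 1).centralBinom ^ 2)
        = (2 * k + 3) * ((k + 1) * (k + 1).centralBinom) ^ 2 := by ring
      _ = 4 * ((2 * k + 3) * (2 * k + 1)) * ((2 * k + 1) * k.centralBinom ^ 2) := by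
        rw [Nat.succ_mul_centralBinom_succ]
        ring
      _ ≤ 4 * (4 * (k + 1) ^ 2) * 16 ^ k :=
        Nat.mul_le_mul (Nat.mul_le_mul_left _ (by nlinarith)) ih
      _ = (k + 1) ^ 2 * 16 ^ (k + 1) := by ring

theorem mul_centralBinom_le_four_pow {a k : ℕ} (h : a ^ 2 ≤ 2 * k + 1) :
    a * k.centralBinom ≤ 4 ^ k := by
  refine (Nat.pow_le_pow_iff_left two_ne_zero).1 ?_
  calc (a * k.centralBinom) ^ 2 = a ^ 2 * k.centralBinom ^ 2 := mul_pow _ _ _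
    _ ≤ (2 * k + 1) * k.centralBinom ^ 2 := Nat.mul_le_mul_right _ h
    _ ≤ 16 ^ k := two_mul_add_one_mul_centralBinom_sq_le k
    _ = (4 ^ k) ^ 2 := by rw [← pow_mul, mul_comm, pow_mul]; norm_num

variable {α : Type*} [Fintype α]

theorem sum_boolSign_eq (s : α → Bool) :
    ∑ k, boolSign (s k) = 2 * (#{k | s k} : ℝ) - Fintype.card α := by
  have h (a : Bool) : boolSign a = 2 * (if a then 1 else 0) - 1 := by
    cases a <;> norm_num [boolSign]
  simp only [h, sum_sub_distrib, ← mul_sum, sum_boole, sum_const, card_univ, nsmul_eq_mul, mul_one]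

variable [DecidableEq α]

theorem card_filter_card_eq (w : ℕ) :
    #{s : α → Bool | #{k | s k} = w} = (Fintype.card α).choose w := by
  rw [← card_univ, ← card_powersetCard]
  exact card_nbij' (fun s => ({k | s k} : Finset α)) (fun u k => decide (k ∈ u))
    (fun s hs => by simpa using hs) (fun u hu => by simpa using hu)
    (fun s _ => by simp) (fun u _ => by simp)

theorem card_abs_sum_boolSign_lt_le (r : ℕ) :
    #{s : α → Bool | |∑ k, boolSign (s k)| < 2 * r} ≤
      (Fintype.card α).choose (Fintype.card α / 2) * (2 * r) := by
  set m := Fintype.card α with hm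
  have hmaps : ∀ s ∈ ({s : α → Bool | |∑ k, boolSign (s k)| < 2 * r} : Finset (α → Bool)),
      #{k | s k} ∈ Ico (m / 2 + 1 - r) ((m + 1) / 2 + r) := by
    intro s hs
    rw [mem_filter_univ, sum_boolSign_eq, ← hm, abs_lt, neg_lt_sub_iff_lt_add,
      sub_lt_iff_lt_add] at hs
    norm_cast at hs
    rw [mem_Ico]
    omega
  refine (card_le_mul_card_image_of_maps_to hmaps _ fun w _ => ?_).trans
    (Nat.mul_le_mul_left _ ?_)
  · calc _ ≤ #{s : α → Bool | #{k | s k} = w} :=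
        card_le_card (filter_subset_filter _ (subset_univ _))
      _ = m.choose w := card_filter_card_eq w
      _ ≤ m.choose (m / 2) := Nat.choose_le_middle w m
  · rw [Nat.card_Ico]
    omega

theorem four_mul_card_abs_sum_boolSign_lt_le {r : ℕ} (hα : Fintype.card α = 64 * r ^ 2) :
    4 * #{s : α → Bool | |∑ k, boolSign (s k)| < 2 * r} ≤ Fintype.card (α → Bool) := by
  have hα' : Fintype.card α = 2 * (32 * r ^ 2) := by omega
  calc _ ≤ 4 * ((2 * (32 * r ^ 2)).choose (2 * (32 * r ^ 2) / 2) * (2 * r)) := by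
        rw [← hα']
        exact Nat.mul_le_mul_left _ (card_abs_sum_boolSign_lt_le r)
    _ = 8 * r * (32 * r ^ 2).centralBinom := by
        rw [Nat.mul_div_cancel_left _ two_pos, ← Nat.centralBinom_eq_two_mul_choose]
        ring
    _ ≤ 4 ^ (32 * r ^ 2) := mul_centralBinom_le_four_pow (by nlinarith)
    _ = Fintype.card (α → Bool) := by
        rw [Fintype.card_fun, Fintype.card_bool, hα', pow_mul 2 2, show 2 ^ 2 = 4 from rfl]

end Anticoncentration

section Clip

/-- The projection of `ℝ` onto `[-1, 1]`. -/
noncomputable def clip (x : ℝ) : ℝ := max (-1) (min 1 x)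

theorem odd_clip : clip.Odd := fun x => by
  unfold clip
  grind

theorem lipschitzWith_clip : LipschitzWith 1 clip := (LipschitzWith.id.const_min 1).const_max (-1)

theorem neg_one_le_clip (x : ℝ) : -1 ≤ clip x := le_max_left _ _

theorem clip_le_one (x : ℝ) : clip x ≤ 1 := max_le (by norm_num) (min_le_left _ _)

theorem abs_clip_le_one (x : ℝ) : |clip x| ≤ 1 := abs_le.2 ⟨neg_one_le_clip x, clip_le_one x⟩

theorem abs_clip_le_abs (x : ℝ) : |clip x| ≤ |x| := by
  unfold clip
  grind

theorem abs_clip_eq_one {x : ℝ} (hx : 1 ≤ |x|) : |clip x| = 1 := by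
  unfold clip
  grind

theorem clip_eq_boolSign_mul_abs (x : ℝ) : clip x = boolSign (0 ≤ x) * |clip x| := by
  rcases le_or_gt 0 x with hx | hx
  · have h : 0 ≤ clip x := le_max_of_le_right (le_min zero_le_one hx)
    simp [boolSign, hx, abs_of_nonneg h]
  · have h : clip x ≤ 0 := max_le (by norm_num) ((min_le_right _ _).trans hx.le)
    simp [boolSign, hx.not_ge, abs_of_nonpos h]

theorem abs_clip_sub_boolSign_mul_clip_le (x : ℝ) (a : Bool) :
    |clip x| - boolSign a * clip x ≤ |x| - boolSign a * x := by
  unfold clip boolSign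
  cases a <;> grind

theorem odd_clip_div (a : ℝ) : Function.Odd fun x => clip (x / a) := fun x => by
  simp only [neg_div, odd_clip _]

theorem lipschitzWith_clip_div (a : NNReal) : LipschitzWith a⁻¹ fun x : ℝ => clip (x / a) := by
  refine LipschitzWith.of_dist_le_mul fun x y => (lipschitzWith_clip.dist_le_mul _ _).trans_eq ?_
  rw [Real.dist_eq, Real.dist_eq, ← sub_div, abs_div, NNReal.abs_eq, NNReal.coe_one, one_mul,
    NNReal.coe_inv, div_eq_inv_mul]

end Clip

section ExpectBlockSum

theorem expect_eval_pi {J β : Type*} [Fintype J] [DecidableEq J] [Fintype β]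
    [Nonempty β] (f : β → ℝ) (j : J) : 𝔼 u : J → β, f (u j) = 𝔼 x, f x := by
  refine (Fintype.expect_equiv (Equiv.funSplitAt j β) _ (fun y => f y.1) fun _ => rfl).trans ?_
  rw [← univ_product_univ, expect_product]
  simp only [Fintype.expect_const]

theorem blockSum_fst_univ {J K : Type*} [Fintype J] [DecidableEq J] [Fintype K]
    (t : J × K → Bool) (j : J) : blockSum Prod.fst univ t j = ∑ k, boolSign (t (j, k)) := by
  rw [blockSum, sum_filter, Fintype.sum_prod_type, sum_eq_single j] <;> simp +contextual

variable {J K : Type*} [Fintype J] [DecidableEq J] [Fintype K] [DecidableEq K]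

theorem expect_slice (f : (K → Bool) → ℝ) (j : J) :
    𝔼 t : J × K → Bool, f (fun k => t (j, k)) = 𝔼 s, f s := by
  exact (Fintype.expect_equiv (Equiv.curry J K Bool) _ (fun u => f (u j)) fun _ => rfl).trans
    (expect_eval_pi f j)

theorem expect_abs_clip_sum_boolSign_ge {r : ℕ} (hr : 0 < r) (hK : Fintype.card K = 64 * r ^ 2) :
    3 / 4 ≤ 𝔼 s : K → Bool, |clip ((∑ k, boolSign (s k)) / (2 * r))| := by
  set B : Finset (K → Bool) := {s | |∑ k, boolSign (s k)| < 2 * r}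
  have hclip (s : K → Bool) :
      1 - (if s ∈ B then 1 else 0) ≤ |clip ((∑ k, boolSign (s k)) / (2 * r))| := by
    split_ifs with hs
    · simp
    · have hr' : (0 : ℝ) < 2 * r := by positivity
      rw [mem_filter_univ, not_lt] at hs
      rw [abs_clip_eq_one, sub_zero]
      rwa [abs_div, abs_of_pos hr', one_le_div hr']
  have hB : 𝔼 s : K → Bool, (if s ∈ B then 1 else 0 : ℝ) ≤ 1 / 4 := by
    have hcard : 4 * #B ≤ Fintype.card (K → Bool) := four_mul_card_abs_sum_boolSign_lt_le hK
    rify at hcard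
    rw [Fintype.expect_eq_sum_div_card, sum_boole, filter_univ_mem, div_le_iff₀ (by positivity)]
    linarith
  calc (3 / 4 : ℝ) ≤ 1 - 𝔼 s : K → Bool, (if s ∈ B then 1 else 0 : ℝ) := by linarith
    _ = 𝔼 s : K → Bool, (1 - (if s ∈ B then 1 else 0 : ℝ)) := by
      rw [expect_sub_distrib, Fintype.expect_const]
    _ ≤ _ := expect_le_expect fun s _ => hclip s

theorem expect_abs_clip_blockSum_ge {r : ℕ} (hr : 0 < r) (hK : Fintype.card K = 64 * r ^ 2)
    (j : J) :
    3 / 4 ≤ 𝔼 t : J × K → Bool, |clip (blockSum Prod.fst univ t j / (2 * r))| := by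
  simp only [blockSum_fst_univ]
  rw [expect_slice (fun s : K → Bool => |clip ((∑ k, boolSign (s k)) / (2 * r))|) j]
  exact expect_abs_clip_sum_boolSign_ge hr hK

end ExpectBlockSum

section PairLoss

/-- The projection of `ℝ` onto `[0, 1]`, the nonlinearity of the hard instance. -/
noncomputable def ramp (x : ℝ) : ℝ := max 0 (min 1 x)

theorem ramp_mem_Lip : ramp ∈ Lip 1 := by
  refine ⟨by simp [ramp], fun x y => ?_⟩
  have h : LipschitzWith 1 ramp := (LipschitzWith.id.const_min 1).const_max 0
  exact h.dist_le_mul x y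

theorem continuous_ramp : Continuous ramp := by
  unfold ramp
  fun_prop

theorem ramp_of_nonpos {x : ℝ} (hx : x ≤ 0) : ramp x = 0 :=
  max_eq_left ((min_le_right _ _).trans hx)

theorem ramp_of_mem_Icc {x : ℝ} (hx : x ∈ Set.Icc 0 1) : ramp x = x := by
  rw [ramp, min_eq_right hx.2, max_eq_right hx.1]

theorem ramp_clip (x : ℝ) : ramp (clip x) = ramp x := by
  unfold ramp clip
  grind

/-- The loss at `x` of the pair of rows `1` and `-1` whose responses are `1, 0` or `0, 1`,
according to the bit `a`. -/
noncomputable def pairLoss (p x : ℝ) (a : Bool) : ℝ :=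
  ∑ s : Bool, |ramp (boolSign s * x) - if a = s then 1 else 0| ^ p

theorem pairLoss_clip (p x : ℝ) (a : Bool) : pairLoss p (clip x) a = pairLoss p x a := by
  have h (s : Bool) : ramp (boolSign s * clip x) = ramp (boolSign s * x) := by
    rw [← ramp_clip (boolSign s * x)]
    cases s <;> simp [boolSign, ramp_clip, odd_clip x]
  simp only [pairLoss, h]

variable {p : ℝ}

theorem pairLoss_boolSign_mul (hp : 0 < p) {u : ℝ} (hu : u ∈ Set.Icc 0 1) (s a : Bool) :
    pairLoss p (boolSign s * u) a = if a = s then (1 - u) ^ p else u ^ p + 1 := by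
  have hneg : ramp (-u) = 0 := ramp_of_nonpos (neg_nonpos.2 hu.1)
  have hsub : |u - 1| = 1 - u := by rw [abs_sub_comm, abs_of_nonneg (sub_nonneg.2 hu.2)]
  cases s <;> cases a <;>
    simp [pairLoss, boolSign, hneg, ramp_of_mem_Icc hu, hsub, abs_of_nonneg hu.1,
      Real.zero_rpow hp.ne', add_comm]

theorem pairLoss_zero (hp : 0 < p) (a : Bool) : pairLoss p 0 a = 1 := by
  simpa [Real.zero_rpow hp.ne'] using
    pairLoss_boolSign_mul hp (Set.left_mem_Icc.2 zero_le_one) true a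

/-- The point of the opposite sign at which the pair loss differs by exactly `1` from the one at
`x`. -/
noncomputable def mirror (x : ℝ) : ℝ := clip x - boolSign (0 ≤ x)

theorem pairLoss_mirror (hp : 0 < p) (x : ℝ) (a : Bool) :
    pairLoss p (mirror x) a = pairLoss p x a + boolSign (0 ≤ x) * boolSign a := by
  have hu : |clip x| ∈ Set.Icc 0 1 := ⟨abs_nonneg _, abs_clip_le_one x⟩
  have hmirror : mirror x = boolSign (!(0 ≤ x : Bool)) * (1 - |clip x|) := by
    rw [mirror, boolSign_not]
    linear_combination clip_eq_boolSign_mul_abs x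
  rw [← pairLoss_clip p x, clip_eq_boolSign_mul_abs, hmirror,
    pairLoss_boolSign_mul hp (Set.Icc.one_sub_mem hu), pairLoss_boolSign_mul hp hu]
  cases decide (0 ≤ x) <;> cases a <;> simp [boolSign]

theorem exists_sum_pairLoss_eq_sub {K : Type*} [Fintype K] (hp : 0 < p) (x : ℝ) (t : K → Bool) :
    ∃ y, ∑ k, pairLoss p y (t k) = ∑ k, pairLoss p x (t k) -
      (|∑ k, boolSign (t k)| - boolSign (0 ≤ x) * ∑ k, boolSign (t k)) / 2 := by
  rw [← abs_boolSign_mul (0 ≤ x : Bool) (∑ k, boolSign (t k))]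
  rcases le_or_gt 0 (boolSign (0 ≤ x) * ∑ k, boolSign (t k)) with h | h
  · exact ⟨x, by rw [abs_of_nonneg h]; ring⟩
  · refine ⟨mirror x, ?_⟩
    simp only [pairLoss_mirror hp, sum_add_distrib, ← mul_sum, abs_of_neg h]
    ring

end PairLoss

section Continuity

variable {n d : ℕ} {p : ℝ} {f : ℝ → ℝ}

theorem continuous_lpPow (hp : 0 ≤ p) : Continuous (lpPow p : (Fin n → ℝ) → ℝ) :=
  continuous_finsetSum _ fun i _ => (continuous_apply i).abs.rpow_const fun _ => Or.inr hp

theorem continuous_loss (hp : 0 ≤ p) (A : Matrix (Fin n) (Fin d) ℝ) (hf : Continuous f)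
    (b : Fin n → ℝ) : Continuous (loss p A f b) := by
  refine (continuous_lpPow hp).comp (continuous_pi fun i => ?_)
  exact (hf.comp ((continuous_apply i).comp (continuous_const.matrix_mulVec continuous_id))).sub
    continuous_const

theorem isClosed_setOf_errorGuarantee (hp : 0 ≤ p) (L ε : ℝ) (A : Matrix (Fin n) (Fin d) ℝ)
    (hf : Continuous f) (b : Fin n → ℝ) : IsClosed {x | ErrorGuarantee p L ε A f b x} := by
  simp only [ErrorGuarantee, Set.ofPred_forall]
  exact isClosed_iInter fun _ => isClosed_iInter fun _ =>
    isClosed_le (continuous_loss hp A hf b) continuous_const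

theorem exists_lex_minimizer_of_retraction {X α β : Type*} [TopologicalSpace X] [Nonempty X]
    [LinearOrder α] [TopologicalSpace α] [OrderClosedTopology α]
    [LinearOrder β] [TopologicalSpace β] [ClosedIicTopology β]
    {F : X → α} {N : X → β} (hF : Continuous F) (hN : Continuous N) {S : Set X}
    (hS : IsCompact S) {c : X → X} (hc : ∀ x, c x ∈ S) (hFc : ∀ x, F (c x) ≤ F x)
    (hNc : ∀ x, N (c x) ≤ N x) :
    ∃ x ∈ S, (∀ y, F x ≤ F y) ∧ ∀ y, (∀ z, F y ≤ F z) → N x ≤ N y := by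
  obtain ⟨x₀, -, hmin⟩ := hS.exists_isMinOn (Set.range_nonempty c |>.mono
    (Set.range_subset_iff.2 hc)) hF.continuousOn
  have hx₀ (y) : F x₀ ≤ F y := (hmin (hc y)).trans (hFc y)
  have hcompact : IsCompact (S ∩ {x | F x ≤ F x₀}) :=
    hS.inter_right (isClosed_le hF continuous_const)
  obtain ⟨x, ⟨hxS, hx⟩, hxN⟩ :=
    hcompact.exists_isMinOn ⟨c x₀, hc x₀, hFc x₀⟩ hN.continuousOn
  exact ⟨x, hxS, fun y => le_trans hx (hx₀ y), fun y hy =>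
    (hxN ⟨hc y, (hFc y).trans (hy x₀)⟩).trans (hNc y)⟩

end Continuity

section HardInstance

variable {n d : ℕ} {K : Type*} (e : (Fin d × K) × Bool ↪ Fin n)

/-- The matrix of the hard instance: every coordinate `j` has the rows `Pi.single j 1` and
`Pi.single j (-1)`, once for each `k : K`, and all rows outside the range of `e` vanish. -/
noncomputable def hardMatrix : Matrix (Fin n) (Fin d) ℝ :=
  Function.extend e (fun r => Pi.single r.1.1 (boolSign r.2)) 0

/-- The responses of the hard instance: the pair of rows `(j, k)` has the responses `1, 0` or
`0, 1`, according to the hidden bit `t (j, k)`. -/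
noncomputable def hardVector (t : Fin d × K → Bool) : Fin n → ℝ :=
  Function.extend e (fun r => if t r.1 = r.2 then 1 else 0) 0

theorem hardMatrix_mulVec_apply (x : Fin d → ℝ) (r : (Fin d × K) × Bool) :
    (hardMatrix e).mulVec x (e r) = boolSign r.2 * x r.1.1 := by
  rw [Matrix.mulVec, hardMatrix, e.injective.extend_apply, single_dotProduct]

theorem hardMatrix_mulVec_of_notMem (x : Fin d → ℝ) {i : Fin n} (hi : i ∉ Set.range e) :
    (hardMatrix e).mulVec x i = 0 := by
  rw [Matrix.mulVec, hardMatrix, Function.extend_apply' _ _ _ hi, Pi.zero_apply, zero_dotProduct]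

theorem hardVector_apply (t : Fin d × K → Bool) (r : (Fin d × K) × Bool) :
    hardVector e t (e r) = if t r.1 = r.2 then 1 else 0 :=
  e.injective.extend_apply _ _ _

theorem hardVector_of_notMem (t : Fin d × K → Bool) {i : Fin n} (hi : i ∉ Set.range e) :
    hardVector e t i = 0 :=
  Function.extend_apply' _ _ _ hi

theorem exists_hardVector_eq [Nonempty (Fin d × K)] (i : Fin n) :
    ∃ k, ∃ g : Bool → ℝ, ∀ t, hardVector e t i = g (t k) := by
  by_cases hi : i ∈ Set.range e
  · obtain ⟨r, rfl⟩ := hi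
    exact ⟨r.1, fun a => if a = r.2 then 1 else 0, fun t => hardVector_apply e t r⟩
  · exact ⟨Classical.arbitrary _, 0, fun t => hardVector_of_notMem e t hi⟩

variable [Fintype K] {p : ℝ}

theorem loss_hard (hp : 0 < p) (t : Fin d × K → Bool) (x : Fin d → ℝ) :
    loss p (hardMatrix e) ramp (hardVector e t) x = ∑ j, ∑ k, pairLoss p (x j) (t (j, k)) := by
  calc _ = ∑ r : (Fin d × K) × Bool,
        |ramp (boolSign r.2 * x r.1.1) - if t r.1 = r.2 then 1 else 0| ^ p :=
      (Fintype.sum_of_injective e e.injective _ _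
        (fun i hi => by
          simp only [hardMatrix_mulVec_of_notMem e x hi, hardVector_of_notMem e t hi,
            ramp_of_nonpos le_rfl, sub_zero, abs_zero, Real.zero_rpow hp.ne'])
        fun r => by simp only [hardMatrix_mulVec_apply, hardVector_apply]).symm
    _ = _ := by
      simp only [Fintype.sum_prod_type, pairLoss]

theorem lpPow_hardMatrix_mulVec (hp : 0 < p) (x : Fin d → ℝ) :
    lpPow p ((hardMatrix e).mulVec x) = 2 * Fintype.card K * ∑ j, |x j| ^ p := by
  calc _ = ∑ r : (Fin d × K) × Bool, |x r.1.1| ^ p :=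
      (Fintype.sum_of_injective e e.injective _ _
        (fun i hi => by
          rw [hardMatrix_mulVec_of_notMem e x hi, abs_zero, Real.zero_rpow hp.ne'])
        fun r => by rw [hardMatrix_mulVec_apply, abs_boolSign_mul]).symm
    _ = _ := by
      simp only [Fintype.sum_prod_type, sum_const, card_univ, Fintype.card_bool, nsmul_eq_mul,
        mul_sum]
      exact sum_congr rfl fun j _ => by push_cast; ring

theorem exists_isMinNormMinimizer_hard (hp : 0 < p) (t : Fin d × K → Bool) :
    ∃ x, IsMinNormMinimizer p (hardMatrix e) ramp (hardVector e t) x ∧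
      lpPow p ((hardMatrix e).mulVec x) ≤ 2 * (d * Fintype.card K) := by
  have hmem (x : Fin d → ℝ) : (fun j => clip (x j)) ∈ Set.Icc (-1 : Fin d → ℝ) 1 :=
    ⟨fun j => neg_one_le_clip (x j), fun j => clip_le_one (x j)⟩
  have hN : Continuous fun x => lpPow p ((hardMatrix e).mulVec x) :=
    (continuous_lpPow hp.le).comp (continuous_const.matrix_mulVec continuous_id)
  obtain ⟨x, hx, hmin⟩ := exists_lex_minimizer_of_retraction
    (continuous_loss hp.le (hardMatrix e) continuous_ramp (hardVector e t)) hN isCompact_Icc hmem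
    (fun x => by simp only [loss_hard e hp, pairLoss_clip, le_refl])
    (fun x => by
      simp only [lpPow_hardMatrix_mulVec e hp]
      exact mul_le_mul_of_nonneg_left (sum_le_sum fun j _ =>
        Real.rpow_le_rpow (abs_nonneg _) (abs_clip_le_abs (x j)) hp.le) (by positivity))
  refine ⟨x, hmin, ?_⟩
  have hsum : ∑ j, |x j| ^ p ≤ d := by
    simpa using sum_le_card_nsmul univ (fun j => |x j| ^ p) 1 fun j _ =>
      Real.rpow_le_one (abs_nonneg _) (abs_le.2 ⟨hx.1 j, hx.2 j⟩) hp.le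
  calc lpPow p ((hardMatrix e).mulVec x) = 2 * Fintype.card K * ∑ j, |x j| ^ p :=
        lpPow_hardMatrix_mulVec e hp x
    _ ≤ 2 * Fintype.card K * d := by gcongr
    _ = 2 * (d * Fintype.card K) := by ring

theorem exists_loss_hard_eq_sub (hp : 0 < p) (t : Fin d × K → Bool) (x : Fin d → ℝ) :
    ∃ y, loss p (hardMatrix e) ramp (hardVector e t) y =
      loss p (hardMatrix e) ramp (hardVector e t) x -
        ∑ j, (|blockSum Prod.fst univ t j| -
          boolSign (0 ≤ x j) * blockSum Prod.fst univ t j) / 2 := by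
  choose y hy using fun j => exists_sum_pairLoss_eq_sub hp (x j) fun k => t (j, k)
  exact ⟨y, by simp only [loss_hard e hp, blockSum_fst_univ, hy, sum_sub_distrib]⟩

variable {ε : ℝ} {t : Fin d × K → Bool} {x : Fin d → ℝ}

theorem ErrorGuarantee.sum_abs_blockSum_sub_le (hp : 0 < p) (hε : 0 ≤ ε)
    (h : ErrorGuarantee p 1 ε (hardMatrix e) ramp (hardVector e t) x) :
    ∑ j, (|blockSum Prod.fst univ t j| - boolSign (0 ≤ x j) * blockSum Prod.fst univ t j) ≤
      6 * ε * (d * Fintype.card K) := by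
  obtain ⟨xstar, hxstar, hnorm⟩ := exists_isMinNormMinimizer_hard e hp t
  obtain ⟨y, hy⟩ := exists_loss_hard_eq_sub e hp t x
  have hopt : loss p (hardMatrix e) ramp (hardVector e t) xstar ≤ d * Fintype.card K :=
    (hxstar.1 0).trans_eq (by simp [loss_hard e hp, pairLoss_zero hp])
  have hupper := h xstar hxstar
  have hlower := hxstar.1 y
  rw [hy, ← sum_div] at hlower
  have herror := mul_le_mul_of_nonneg_left (add_le_add hopt hnorm) hε
  rw [Real.one_rpow, one_mul] at hupper
  linarith

theorem ErrorGuarantee.sum_abs_clip_sub_le {r : ℕ} (hr : 0 < r)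
    (hK : Fintype.card K = 64 * r ^ 2) (hp : 0 < p) (hε : 0 ≤ ε) (hεr : 4000 * ε * r ≤ 1)
    (h : ErrorGuarantee p 1 ε (hardMatrix e) ramp (hardVector e t) x) :
    ∑ j, (|clip (blockSum Prod.fst univ t j / (2 * r))| -
      boolSign (0 ≤ x j) * clip (blockSum Prod.fst univ t j / (2 * r))) ≤ d / 20 := by
  have hscale (y : ℝ) (a : Bool) : |clip (y / (2 * r))| - boolSign a * clip (y / (2 * r)) ≤
      (|y| - boolSign a * y) / (2 * r) := by
    refine (abs_clip_sub_boolSign_mul_clip_le _ a).trans_eq ?_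
    rw [abs_div, abs_of_nonneg (by positivity : (0 : ℝ) ≤ 2 * r)]
    ring
  calc _ ≤ ∑ j, (|blockSum Prod.fst univ t j| -
        boolSign (0 ≤ x j) * blockSum Prod.fst univ t j) / (2 * r) :=
      sum_le_sum fun j _ => hscale _ _
    _ ≤ 6 * ε * (d * Fintype.card K) / (2 * r) := by
      rw [← sum_div]
      gcongr
      exact h.sum_abs_blockSum_sub_le e hp hε
    _ = 48 / 1000 * d * (4000 * ε * r) := by
      rw [hK]
      push_cast
      field_simp
      ring
    _ ≤ 48 / 1000 * d * 1 := by gcongr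
    _ ≤ d / 20 := by linarith [(Nat.cast_nonneg d : (0 : ℝ) ≤ d)]

end HardInstance

section LowerBound

theorem expect_le_add_mul {τ : Type*} [Fintype τ] [Nonempty τ] {g : τ → ℝ} {A : Finset τ}
    {a b δ : ℝ} (hb : 0 ≤ b) (hA : (1 - δ) * Fintype.card τ ≤ #A) (hg : ∀ t, g t ≤ a + b)
    (hgA : ∀ t ∈ A, g t ≤ a) : 𝔼 t, g t ≤ a + δ * b := by
  classical
  have hcompl : (#Aᶜ : ℝ) ≤ δ * Fintype.card τ := by
    rw [card_compl, Nat.cast_sub (card_le_univ A)]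
    linarith
  have hpoint (t : τ) : g t ≤ a + if t ∈ Aᶜ then b else 0 := by
    split_ifs with ht
    · exact hg t
    · simpa using hgA t (by simpa using ht)
  rw [Fintype.expect_eq_sum_div_card, div_le_iff₀ (by positivity)]
  calc ∑ t, g t ≤ ∑ t, (a + if t ∈ Aᶜ then b else 0) := sum_le_sum fun t _ => hpoint t
    _ = a * Fintype.card τ + #Aᶜ * b := by
      rw [sum_add_distrib, sum_ite_mem, univ_inter, sum_const, sum_const, card_univ, nsmul_eq_mul,
        nsmul_eq_mul, mul_comm a]
    _ ≤ a * Fintype.card τ + δ * Fintype.card τ * b := by gcongr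
    _ = (a + δ * b) * Fintype.card τ := by ring

theorem exists_card_le_of_forall_measureReal_ge {Ω τ : Type*} [MeasurableSpace Ω] [Finite τ]
    (P : Measure Ω) [IsProbabilityMeasure P] {S : τ → Set Ω} (hS : ∀ t, MeasurableSet (S t))
    {c : ℝ} (hc : ∀ t, c ≤ P.real (S t)) {G : Ω → Prop} (hG : ∀ᵐ ω ∂P, G ω) :
    ∃ ω, G ω ∧ ∃ A : Finset τ, (∀ t ∈ A, ω ∈ S t) ∧ c * Nat.card τ ≤ #A := by
  classical
  have := Fintype.ofFinite τ
  have hint (t : τ) : Integrable ((S t).indicator (1 : Ω → ℝ)) P :=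
    (integrable_const (1 : ℝ)).indicator (hS t)
  obtain ⟨ω, hω, h⟩ := exists_notMem_null_integral_le
    (integrable_finsetSum univ fun t _ => hint t) (ae_iff.1 hG)
  refine ⟨ω, not_not.1 hω, univ.filter (ω ∈ S ·), fun t ht => (mem_filter_univ t).1 ht, ?_⟩
  rw [Nat.card_eq_fintype_card]
  calc c * Fintype.card τ ≤ ∑ t, P.real (S t) := by
        simpa [mul_comm] using card_nsmul_le_sum univ (fun t => P.real (S t)) c fun t _ => hc t
    _ = ∫ ω, ∑ t, (S t).indicator (1 : Ω → ℝ) ω ∂P := by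
        simp only [integral_finsetSum _ fun t _ => hint t, integral_indicator_one (hS _)]
    _ ≤ ∑ t, (S t).indicator (1 : Ω → ℝ) ω := h
    _ = #(univ.filter (ω ∈ S ·)) := by simp only [Set.indicator_apply, Pi.one_apply, sum_boole]

theorem exists_nat_mul_le_one {x : ℝ} (hx : 0 < x) (hx1 : x ≤ 1) :
    ∃ r : ℕ, r * x ≤ 1 ∧ 1 ≤ 2 * (r * x) := by
  have hfloor : 1 ≤ ⌊1 / x⌋₊ := Nat.one_le_floor_iff _ |>.2 ((one_le_div hx).2 hx1)
  have hlt := (div_lt_iff₀ hx).1 (Nat.lt_floor_add_one (1 / x))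
  have hle : 1 * x ≤ ⌊1 / x⌋₊ * x := by
    gcongr
    exact_mod_cast hfloor
  exact ⟨⌊1 / x⌋₊, (le_div_iff₀ hx).1 (Nat.floor_le (by positivity)), by linarith⟩

variable {n d r q : ℕ} {K : Type*} [Fintype K] (e : (Fin d × K) × Bool ↪ Fin n)

theorem QueryTree.expect_corr_hardVector_le [DecidableEq K] [Nonempty (Fin d × K)] (hr : 0 < r)
    (T : QueryTree n d) (hq : ∀ t, T.numQueries (hardVector e t) ≤ q) :
    𝔼 t, ∑ j, boolSign (0 ≤ T.eval (hardVector e t) j) *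
      clip (blockSum Prod.fst univ t j / (2 * r)) ≤ d / 8 + q / (2 * r ^ 2) := by
  have hlip : LipschitzWith (2 * r)⁻¹ fun x : ℝ => clip (x / (2 * r)) := by
    simpa using lipschitzWith_clip_div (2 * r)
  have hμ : (0 : ℝ) < 1 / (2 * r ^ 2) := by positivity
  refine (T.expect_corr_le Prod.fst (odd_clip_div (2 * r)) hlip hμ (exists_hardVector_eq e)
    (s := fun x j => boolSign (0 ≤ x j)) (fun x j => (abs_boolSign _).le) hq).trans_eq ?_
  simp only [Fintype.card_fin, NNReal.coe_inv, NNReal.coe_mul, NNReal.coe_ofNat,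
    NNReal.coe_natCast]
  field_simp
  ring

variable {p ε : ℝ}

theorem QueryTree.expect_abs_clip_sub_le [DecidableEq K] (hr : 0 < r)
    (hK : Fintype.card K = 64 * r ^ 2) (hp : 0 < p) (hε : 0 ≤ ε) (hεr : 4000 * ε * r ≤ 1)
    (T : QueryTree n d) {A : Finset (Fin d × K → Bool)}
    (hA : 4 / 5 * (Fintype.card (Fin d × K → Bool) : ℝ) ≤ #A)
    (hT : ∀ t ∈ A, ErrorGuarantee p 1 ε (hardMatrix e) ramp (hardVector e t)
      (T.eval (hardVector e t))) :
    𝔼 t : Fin d × K → Bool, ∑ j, (|clip (blockSum Prod.fst univ t j / (2 * r))| -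
      boolSign (0 ≤ T.eval (hardVector e t) j) *
        clip (blockSum Prod.fst univ t j / (2 * r))) ≤ d / 20 + 1 / 5 * (d * 2) := by
  have hle_two (x : ℝ) (a : Bool) : |clip x| - boolSign a * clip x ≤ 2 := by
    linarith [abs_clip_le_one x, neg_abs_le (boolSign a * clip x), abs_boolSign_mul a (clip x)]
  refine expect_le_add_mul (A := A) (by positivity) (by linarith) (fun t => ?_) fun t ht =>
    (hT t ht).sum_abs_clip_sub_le e hr hK hp hε hεr
  refine (sum_le_card_nsmul univ _ 2 fun j _ => hle_two _ _).trans ?_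
  rw [card_univ, Fintype.card_fin, nsmul_eq_mul]
  exact le_add_of_nonneg_left (by positivity)

theorem QueryTree.mul_sq_le_of_errorGuarantee (hr : 0 < r) (hK : Fintype.card K = 64 * r ^ 2)
    (hp : 0 < p) (hε : 0 ≤ ε) (hεr : 4000 * ε * r ≤ 1) (T : QueryTree n d)
    (hq : ∀ t, T.numQueries (hardVector e t) ≤ q) {A : Finset (Fin d × K → Bool)}
    (hA : 4 / 5 * (Nat.card (Fin d × K → Bool) : ℝ) ≤ #A)
    (hT : ∀ t ∈ A, ErrorGuarantee p 1 ε (hardMatrix e) ramp (hardVector e t)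
      (T.eval (hardVector e t))) :
    (d * r ^ 2 : ℝ) ≤ 3 * q := by
  classical
  rcases Nat.eq_zero_or_pos d with rfl | hd
  · simp
  have : NeZero d := ⟨hd.ne'⟩
  have : Nonempty K := Fintype.card_pos_iff.1 (by rw [hK]; positivity)
  have hsum : (d * (3 / 4) : ℝ) ≤
      𝔼 t : Fin d × K → Bool, ∑ j, |clip (blockSum Prod.fst univ t j / (2 * r))| := by
    rw [expect_sum_comm]
    simpa using card_nsmul_le_sum univ _ _ fun (j : Fin d) _ =>
      expect_abs_clip_blockSum_ge (K := K) hr hK j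
  have hcorr := T.expect_corr_hardVector_le e hr hq
  have hgap := T.expect_abs_clip_sub_le e hr hK hp hε hεr
    (by simpa only [Nat.card_eq_fintype_card] using hA) hT
  simp only [sum_sub_distrib, expect_sub_distrib] at hgap
  have hd_le : (d : ℝ) / 3 ≤ q / r ^ 2 := by
    have hhalf : (q : ℝ) / (2 * r ^ 2) = q / r ^ 2 / 2 := by field_simp
    have hd0 : (0 : ℝ) < d := by exact_mod_cast hd
    linarith
  rw [le_div_iff₀ (by positivity)] at hd_le
  linarith

end LowerBound

theorem RandomizedAlgorithm.mul_sq_le_of_succeeds {n d r q : ℕ} {K : Type*} [Fintype K]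
    (e : (Fin d × K) × Bool ↪ Fin n) (hr : 0 < r) (hK : Fintype.card K = 64 * r ^ 2) {p ε : ℝ}
    (hp : 0 < p) (hε : 0 ≤ ε) (hεr : 4000 * ε * r ≤ 1) (𝒜 : RandomizedAlgorithm.{u} n d)
    (h𝒜 : 𝒜.Succeeds p ε) (hq : 𝒜.MakesAtMost q) : (d * r ^ 2 : ℝ) ≤ 3 * q := by
  have hmeas (t : Fin d × K → Bool) := 𝒜.measurable_eval (hardMatrix e) ramp (hardVector e t)
    (isClosed_setOf_errorGuarantee hp.le 1 ε (hardMatrix e) continuous_ramp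
      (hardVector e t)).measurableSet
  have hprob (t : Fin d × K → Bool) := ENNReal.toReal_mono (measure_ne_top 𝒜.P _)
    (h𝒜 (hardMatrix e) ramp ramp_mem_Lip (hardVector e t))
  obtain ⟨ω, hω, A, hA, hcard⟩ := exists_card_le_of_forall_measureReal_ge 𝒜.P hmeas hprob
    (ae_all_iff.2 fun t => hq (hardMatrix e) ramp ramp_mem_Lip (hardVector e t))
  exact (𝒜.tree (hardMatrix e) ramp ω).mul_sq_le_of_errorGuarantee e hr hK hp hε hεr hω
    (by simpa using hcard) hA

theorem theorem2_general {p : ℝ} (hp : 0 < p) {ε : ℝ} (hε : 0 < ε) (hε₀ : ε ≤ 1 / 4000) {n d : ℕ}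
    (hn : d / ε ^ 2 ≤ n) (𝒜 : RandomizedAlgorithm.{u} n d) (h𝒜 : 𝒜.Succeeds p ε) {q : ℕ}
    (hq : 𝒜.MakesAtMost q) : 1 / (3 * 8000 ^ 2) * d / ε ^ 2 ≤ q := by
  obtain ⟨r, hr_le, hr_ge⟩ :=
    exists_nat_mul_le_one (x := 4000 * ε) (by positivity) (by linarith)
  have hr : 0 < r := Nat.pos_of_ne_zero fun h => by norm_num [h] at hr_ge
  have hcard : d * (64 * r ^ 2) * 2 ≤ n := by
    have hsq : 128 * r ^ 2 ≤ 1 / ε ^ 2 := by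
      rw [le_div_iff₀ (by positivity)]
      nlinarith [pow_le_one₀ (n := 2) (by positivity) hr_le]
    have h : (d * (128 * r ^ 2) : ℝ) ≤ n := by
      refine le_trans ?_ hn
      rw [div_eq_mul_one_div]
      gcongr
    exact_mod_cast (by linarith : (d * (64 * r ^ 2) * 2 : ℝ) ≤ n)
  obtain ⟨e⟩ : Nonempty ((Fin d × Fin (64 * r ^ 2)) × Bool ↪ Fin n) :=
    Function.Embedding.nonempty_of_card_le (by simpa using hcard)
  have hmain : (d * r ^ 2 : ℝ) ≤ 3 * q :=
    𝒜.mul_sq_le_of_succeeds e hr (Fintype.card_fin _) hp hε.le (by linarith) h𝒜 hq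
  have hsq : 1 / ε ^ 2 ≤ 8000 ^ 2 * r ^ 2 := by
    rw [div_le_iff₀ (by positivity)]
    linarith [one_le_pow₀ (n := 2) hr_ge]
  rw [div_eq_mul_one_div]
  calc (1 / (3 * 8000 ^ 2) * d * (1 / ε ^ 2) : ℝ)
      ≤ 1 / (3 * 8000 ^ 2) * d * (8000 ^ 2 * r ^ 2) := by gcongr
    _ ≤ q := by linarith

theorem theorem2 (p : ℝ) (hp : 1 ≤ p) :
    ∃ ε₀ > (0 : ℝ), ∃ C > (0 : ℝ), ∃ c > (0 : ℝ),
      ∀ ε : ℝ, 0 < ε → ε ≤ ε₀ →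
      ∀ n d : ℕ, C * (d * max 1 (Real.log d)) / ε ^ 2 ≤ n →
      ∀ 𝒜 : RandomizedAlgorithm.{u} n d, 𝒜.Succeeds p ε →
      ∀ q : ℕ, 𝒜.MakesAtMost q → c * d / ε ^ 2 ≤ q := by
  refine ⟨1 / 4000, by norm_num, 1, one_pos, 1 / (3 * 8000 ^ 2), by norm_num,
    fun ε hε hε₀ n d hn 𝒜 h𝒜 q hq =>
      theorem2_general (one_pos.trans_le hp) hε hε₀ (le_trans ?_ hn) 𝒜 h𝒜 hq⟩
  rw [one_mul]
  gcongr
  exact le_mul_of_one_le_right d.cast_nonneg (le_max_left _ _)
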